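/- For each pair of real numbers $a, b > 0$ let $X_{a,b}$ be a random variable with the Beta distribution $\mathrm{Beta}(a,b)$, that is, with density $x^{a-1}(1-x)^{b-1}/B(a,b)$ on $(0,1)$, where $B(a,b)=\int_0^1 y^{a-1}(1-y)^{b-1}\,dy$. Then the map $(a,b) \mapsto \mathbb{P}\bigl(X_{a,b} \ge \mathbb{E}(X_{a,b})\bigr)$ on $(0,\infty)^2$ is increasing in $a$ (for each fixed $b$) and decreasing in $b$ (for each fixed $a$), where increasing and decreasing are meant in the non-strict sense. -/

import Mathlib

open MeasureTheory ProbabilityTheory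

open scoped ENNReal

/-! Move the mean to the origin by an affine change of variable, scaled so that the unnormalized
density `g` satisfies `w * g w = -K' w`, where `K` is `betaKernel` and `K 0 = 1`. Then `(log K)' w =
-w / ((1 + α w)(1 - β w))`. Raising `a` or lowering `b` lowers `α` and raises `β`, so for `w > 0`
the kernel decays faster (`betaKernel_le_betaKernel`) and the truncated first moments `1 - K t`
grow. Integrating these against `t ^ (-2)` recovers the mass of `g` above the mean, which therefore
grows too (`lintegral_betaScaledPDF_mono`). The reflection `x ↦ 1 - x` swaps the parameters, so the
same comparison shows that the mass below the mean shrinks. Both masses carry the same normalizing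
constant, so the odds of lying above the mean increase, and with them the probability. -/

theorem lintegral_Ioi_inv_sq {w : ℝ} (hw : 0 < w) :
    ∫⁻ t in Set.Ioi w, ENNReal.ofReal (t ^ (-2 : ℝ)) = ENNReal.ofReal w⁻¹ := by
  rw [← ofReal_integral_eq_lintegral_ofReal
    (integrableOn_Ioi_rpow_of_lt (by norm_num) hw), integral_Ioi_rpow_of_lt (by norm_num) hw]
  · congr 1
    norm_num [Real.rpow_neg_one]
  · filter_upwards [ae_restrict_mem measurableSet_Ioi] with t ht
    exact Real.rpow_nonneg (hw.trans ht).le _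

/-- The integral of `g` over the positive half-line in terms of its truncated first moments. -/
theorem lintegral_Ioi_eq_lintegral_truncated_moment {g : ℝ → ℝ≥0∞} (hg : Measurable g) :
    ∫⁻ w in Set.Ioi (0 : ℝ), g w =
      ∫⁻ t in Set.Ioi (0 : ℝ), ENNReal.ofReal (t ^ (-2 : ℝ)) *
        ∫⁻ w in Set.Ioo 0 t, ENNReal.ofReal w * g w := by
  have hmeas : Measurable (fun p : ℝ × ℝ => (if p.1 < p.2 then
      ENNReal.ofReal (p.2 ^ (-2 : ℝ)) * (ENNReal.ofReal p.1 * g p.1) else 0)) :=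
    Measurable.ite (measurableSet_lt measurable_fst measurable_snd) (by fun_prop) (by fun_prop)
  calc ∫⁻ w in Set.Ioi (0 : ℝ), g w
      = ∫⁻ w in Set.Ioi (0 : ℝ), ∫⁻ t in Set.Ioi (0 : ℝ), (if w < t then
          ENNReal.ofReal (t ^ (-2 : ℝ)) * (ENNReal.ofReal w * g w) else 0) := by
        refine setLIntegral_congr_fun measurableSet_Ioi fun w (hw : 0 < w) => ?_
        have h1 : (fun t : ℝ => (if w < t then
            ENNReal.ofReal (t ^ (-2 : ℝ)) * (ENNReal.ofReal w * g w) else 0)) =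
            (Set.Ioi w).indicator
              (fun t => ENNReal.ofReal (t ^ (-2 : ℝ)) * (ENNReal.ofReal w * g w)) := by
          ext t; simp [Set.indicator_apply]
        simp only [h1]
        rw [setLIntegral_indicator measurableSet_Ioi,
          Set.inter_eq_left.2 (Set.Ioi_subset_Ioi hw.le),
          lintegral_mul_const _ (by fun_prop), lintegral_Ioi_inv_sq hw, ← mul_assoc,
          ← ENNReal.ofReal_mul (by positivity), inv_mul_cancel₀ hw.ne']
        simp
    _ = ∫⁻ t in Set.Ioi (0 : ℝ), ∫⁻ w in Set.Ioi (0 : ℝ), (if w < t then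
          ENNReal.ofReal (t ^ (-2 : ℝ)) * (ENNReal.ofReal w * g w) else 0) :=
        lintegral_lintegral_swap hmeas.aemeasurable
    _ = _ := by
        refine setLIntegral_congr_fun measurableSet_Ioi fun t (ht : 0 < t) => ?_
        have h1 : (fun w : ℝ => (if w < t then
            ENNReal.ofReal (t ^ (-2 : ℝ)) * (ENNReal.ofReal w * g w) else 0)) =
            (Set.Iio t).indicator
              (fun w => ENNReal.ofReal (t ^ (-2 : ℝ)) * (ENNReal.ofReal w * g w)) := by
          ext w; simp [Set.indicator_apply]
        simp only [h1]
        rw [setLIntegral_indicator measurableSet_Iio, Set.inter_comm, Set.Ioi_inter_Iio,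
          lintegral_const_mul _ (by fun_prop)]

theorem lintegral_Ioi_le_of_truncated_moment_le {g g' : ℝ → ℝ≥0∞} (hg : Measurable g)
    (hg' : Measurable g')
    (h : ∀ t, 0 < t → ∫⁻ w in Set.Ioo 0 t, ENNReal.ofReal w * g w ≤
      ∫⁻ w in Set.Ioo 0 t, ENNReal.ofReal w * g' w) :
    ∫⁻ w in Set.Ioi (0 : ℝ), g w ≤ ∫⁻ w in Set.Ioi (0 : ℝ), g' w := by
  rw [lintegral_Ioi_eq_lintegral_truncated_moment hg,
    lintegral_Ioi_eq_lintegral_truncated_moment hg']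
  exact setLIntegral_mono' measurableSet_Ioi fun t ht => mul_le_mul_right (h t ht) _

/-! ### The centred kernel and its truncated first moments -/

/-- `x ^ a * (1 - x) ^ b` normalized to have its maximum, with value `1`, at the origin, where
`a * (α * (α + β)) = 1` and `b * (β * (α + β)) = 1`. -/
noncomputable def betaKernel (a b α β w : ℝ) : ℝ := (1 + α * w) ^ a * (1 - β * w) ^ b

/-- The beta density, affinely normalized so that the mean is the origin. -/
noncomputable def betaScaledPDF (a b α β w : ℝ) : ℝ≥0∞ :=
  if w < β⁻¹ then ENNReal.ofReal ((1 + α * w) ^ (a - 1) * (1 - β * w) ^ (b - 1)) else 0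

theorem measurable_betaScaledPDF (a b α β : ℝ) : Measurable (betaScaledPDF a b α β) :=
  Measurable.ite measurableSet_Iio (by fun_prop) (by fun_prop)

theorem one_sub_mul_pos_of_lt_inv {β w : ℝ} (hβ : 0 < β) (hw : w < β⁻¹) : 0 < 1 - β * w := by
  have := mul_lt_mul_of_pos_left hw hβ
  rw [mul_inv_cancel₀ hβ.ne'] at this
  linarith

theorem hasDerivAt_betaKernel {a b α β w : ℝ} (h : a * α = b * β) (h1 : a * α * (α + β) = 1)
    (hw : 0 < 1 + α * w) (hw' : 0 < 1 - β * w) :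
    HasDerivAt (betaKernel a b α β)
      (-(w * ((1 + α * w) ^ (a - 1) * (1 - β * w) ^ (b - 1)))) w := by
  have e1 : HasDerivAt (fun w => 1 + α * w) α w := by
    simpa using ((hasDerivAt_id w).const_mul α).const_add 1
  have e2 : HasDerivAt (fun w => 1 - β * w) (-β) w := by
    simpa using ((hasDerivAt_id w).const_mul β).const_sub 1
  have e := (e1.rpow_const (p := a) (Or.inl hw.ne')).mul
    (e2.rpow_const (p := b) (Or.inl hw'.ne'))
  refine e.congr_deriv ?_
  have p1 : (1 + α * w) ^ a = (1 + α * w) ^ (a - 1) * (1 + α * w) := by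
    rw [← Real.rpow_add_one hw.ne']; simp
  have p2 : (1 - β * w) ^ b = (1 - β * w) ^ (b - 1) * (1 - β * w) := by
    rw [← Real.rpow_add_one hw'.ne']; simp
  rw [p1, p2]
  linear_combination (1 + α * w) ^ (a - 1) * (1 - β * w) ^ (b - 1) * ((1 + α * w) * h - w * h1)

theorem continuous_betaKernel {a b : ℝ} (ha : 0 < a) (hb : 0 < b) (α β : ℝ) :
    Continuous (betaKernel a b α β) := by
  unfold betaKernel
  exact ((by fun_prop : Continuous fun w => 1 + α * w).rpow_const fun _ => Or.inr ha.le).mul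
    ((by fun_prop : Continuous fun w => 1 - β * w).rpow_const fun _ => Or.inr hb.le)

theorem lintegral_Ioo_mul_betaScaledPDF {a b α β t : ℝ} (ha : 0 < a) (hb : 0 < b) (hα : 0 < α)
    (hβ : 0 < β) (h : a * α = b * β) (h1 : a * α * (α + β) = 1) (ht : 0 < t) (ht' : t ≤ β⁻¹) :
    ∫⁻ w in Set.Ioo 0 t, ENNReal.ofReal w * betaScaledPDF a b α β w =
      ENNReal.ofReal (1 - betaKernel a b α β t) := by
  have hc : ContinuousOn (fun w => - betaKernel a b α β w) (Set.Icc 0 t) :=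
    (continuous_betaKernel ha hb α β).neg.continuousOn
  have hd : ∀ w ∈ Set.Ioo 0 t, HasDerivAt (fun w => - betaKernel a b α β w)
      (w * ((1 + α * w) ^ (a - 1) * (1 - β * w) ^ (b - 1))) w := fun w hw => by
    have h2 : 0 < 1 + α * w := by have := mul_pos hα hw.1; linarith
    exact (hasDerivAt_betaKernel h h1 h2
      (one_sub_mul_pos_of_lt_inv hβ (hw.2.trans_le ht'))).neg.congr_deriv (neg_neg _)
  have hpos : ∀ w ∈ Set.Ioo 0 t,
      0 ≤ w * ((1 + α * w) ^ (a - 1) * (1 - β * w) ^ (b - 1)) := fun w hw => by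
    have h2 : 0 < 1 + α * w := by have := mul_pos hα hw.1; linarith
    have h3 := one_sub_mul_pos_of_lt_inv hβ (hw.2.trans_le ht')
    have := hw.1
    positivity
  have hi := intervalIntegral.integrableOn_deriv_of_nonneg hc hd hpos
  have hI := intervalIntegral.integral_eq_sub_of_hasDerivAt_of_le ht.le hc hd
    ((intervalIntegrable_iff_integrableOn_Ioc_of_le ht.le).2 hi)
  have h0 : betaKernel a b α β 0 = 1 := by simp [betaKernel]
  rw [h0, intervalIntegral.integral_of_le ht.le, integral_Ioc_eq_integral_Ioo] at hI
  rw [show 1 - betaKernel a b α β t = -betaKernel a b α β t - -1 by ring, ← hI,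
    ofReal_integral_eq_lintegral_ofReal (hi.mono_set Set.Ioo_subset_Ioc_self)
      ((ae_restrict_iff' measurableSet_Ioo).2 (ae_of_all _ hpos))]
  refine setLIntegral_congr_fun measurableSet_Ioo fun w hw => ?_
  simp only [betaScaledPDF]
  rw [if_pos (hw.2.trans_le ht'), ENNReal.ofReal_mul hw.1.le]

theorem lintegral_Ioo_mul_betaScaledPDF_le_one {a b α β t : ℝ} (ha : 0 < a) (hb : 0 < b)
    (hα : 0 < α) (hβ : 0 < β) (h : a * α = b * β) (h1 : a * α * (α + β) = 1) (ht : 0 < t) :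
    ∫⁻ w in Set.Ioo 0 t, ENNReal.ofReal w * betaScaledPDF a b α β w ≤ 1 := by
  have hind : (fun w => ENNReal.ofReal w * betaScaledPDF a b α β w) =
      (Set.Iio β⁻¹).indicator (fun w => ENNReal.ofReal w * betaScaledPDF a b α β w) := by
    ext w
    by_cases hw : w < β⁻¹ <;> simp [betaScaledPDF, hw]
  have hpos : 0 < min t β⁻¹ := lt_min ht (inv_pos.2 hβ)
  rw [hind, setLIntegral_indicator measurableSet_Iio, Set.inter_comm, Set.Ioo_inter_Iio,
    lintegral_Ioo_mul_betaScaledPDF ha hb hα hβ h h1 hpos (min_le_right _ _)]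
  refine ENNReal.ofReal_le_one.2 (sub_le_self _ (mul_nonneg ?_ ?_)) <;>
    refine Real.rpow_nonneg ?_ _
  · positivity
  · have := mul_le_mul_of_nonneg_left (min_le_right t β⁻¹) hβ.le
    rw [mul_inv_cancel₀ hβ.ne'] at this
    linarith

/-- The scaling makes both logarithmic derivatives `-w / ((1 + α w)(1 - β w))`, with no other
dependence on the parameters. A smaller `α` and a larger `β` shrink both positive factors, so that
logarithm falls faster from the common value `0`. -/
theorem betaKernel_le_betaKernel {a b α β a' b' α' β' t : ℝ} (hα' : 0 < α') (hβ : 0 < β)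
    (hα : α' ≤ α) (hβ' : β ≤ β') (h : a * α = b * β) (h1 : a * α * (α + β) = 1)
    (h' : a' * α' = b' * β') (h1' : a' * α' * (α' + β') = 1) (ht : 0 ≤ t) (ht' : t < β'⁻¹) :
    betaKernel a' b' α' β' t ≤ betaKernel a b α β t := by
  have aux : ∀ {a b α β w : ℝ}, 0 < 1 + α * w → 0 < 1 - β * w → a * α = b * β →
      a * α * (α + β) = 1 →
      HasDerivAt (fun w => a * Real.log (1 + α * w) + b * Real.log (1 - β * w))
        (-(w / ((1 + α * w) * (1 - β * w)))) w := by
    intro a b α β w hw hw' h h1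
    have e1 : HasDerivAt (fun w => 1 + α * w) α w := by
      simpa using ((hasDerivAt_id w).const_mul α).const_add 1
    have e2 : HasDerivAt (fun w => 1 - β * w) (-β) w := by
      simpa using ((hasDerivAt_id w).const_mul β).const_sub 1
    refine (((e1.log hw.ne').const_mul a).add ((e2.log hw'.ne').const_mul b)).congr_deriv ?_
    have n1 := hw.ne'
    have n2 := hw'.ne'
    -- Each factor becomes an atom, so that `field_simp` clears denominators without expanding it.
    generalize hp : 1 + α * w = p at *
    generalize hq : 1 - β * w = q at *
    field_simp
    subst hp hq
    linear_combination (1 + α * w) * h - w * h1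
  have hβ'0 : 0 < β' := hβ.trans_le hβ'
  have hA : ∀ w, 0 ≤ w → 0 < 1 + α' * w ∧ 1 + α' * w ≤ 1 + α * w := fun w hw =>
    ⟨by positivity, by gcongr⟩
  have hB : ∀ w, 0 ≤ w → w ≤ t → 0 < 1 - β' * w ∧ 1 - β' * w ≤ 1 - β * w := fun w hw hwt =>
    ⟨one_sub_mul_pos_of_lt_inv hβ'0 (hwt.trans_lt ht'), by gcongr⟩
  have hd : ∀ w ∈ Set.Icc 0 t, HasDerivAt
      (fun w => (a' * Real.log (1 + α' * w) + b' * Real.log (1 - β' * w)) -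
        (a * Real.log (1 + α * w) + b * Real.log (1 - β * w)))
      (-(w / ((1 + α' * w) * (1 - β' * w))) - -(w / ((1 + α * w) * (1 - β * w)))) w := by
    intro w hw
    obtain ⟨p1, p2⟩ := hA w hw.1
    obtain ⟨q1, q2⟩ := hB w hw.1 hw.2
    exact (aux p1 q1 h' h1').sub (aux (p1.trans_le p2) (q1.trans_le q2) h h1)
  have hanti := antitoneOn_of_hasDerivWithinAt_nonpos (convex_Icc 0 t)
    (fun w hw => (hd w hw).continuousAt.continuousWithinAt)
    (fun w hw => (hd w (interior_subset hw)).hasDerivWithinAt)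
    (fun w hw => by
      have hw := interior_subset hw
      obtain ⟨p1, p2⟩ := hA w hw.1
      obtain ⟨q1, q2⟩ := hB w hw.1 hw.2
      have := hw.1
      have := p1.trans_le p2
      rw [sub_neg_eq_add, neg_add_nonpos_iff]
      gcongr)
  have key := hanti (Set.left_mem_Icc.2 ht) (Set.right_mem_Icc.2 ht) ht
  simp only [mul_zero, add_zero, sub_zero, Real.log_one] at key
  obtain ⟨p1, p2⟩ := hA t ht
  obtain ⟨q1, q2⟩ := hB t ht le_rfl
  have r1 := p1.trans_le p2
  have r2 := q1.trans_le q2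
  unfold betaKernel
  rw [Real.rpow_def_of_pos p1, Real.rpow_def_of_pos q1, Real.rpow_def_of_pos r1,
    Real.rpow_def_of_pos r2, ← Real.exp_add, ← Real.exp_add, Real.exp_le_exp]
  linarith

theorem lintegral_betaScaledPDF_mono {a b α β a' b' α' β' : ℝ} (ha : 0 < a) (hb : 0 < b)
    (ha' : 0 < a') (hb' : 0 < b') (hα' : 0 < α') (hβ : 0 < β)
    (hα : α' ≤ α) (hβ' : β ≤ β') (h : a * α = b * β) (h1 : a * α * (α + β) = 1)
    (h' : a' * α' = b' * β') (h1' : a' * α' * (α' + β') = 1) :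
    ∫⁻ w in Set.Ioi (0 : ℝ), betaScaledPDF a b α β w ≤
      ∫⁻ w in Set.Ioi (0 : ℝ), betaScaledPDF a' b' α' β' w := by
  have hβ'0 : 0 < β' := hβ.trans_le hβ'
  have hα0 : 0 < α := hα'.trans_le hα
  refine lintegral_Ioi_le_of_truncated_moment_le (measurable_betaScaledPDF _ _ _ _)
    (measurable_betaScaledPDF _ _ _ _) fun t ht => ?_
  rcases lt_or_ge t β'⁻¹ with htβ | htβ
  · rw [lintegral_Ioo_mul_betaScaledPDF ha' hb' hα' hβ'0 h' h1' ht htβ.le,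
      lintegral_Ioo_mul_betaScaledPDF ha hb hα0 hβ h h1 ht (htβ.le.trans (by gcongr))]
    gcongr
    exact betaKernel_le_betaKernel hα' hβ hα hβ' h h1 h' h1' ht.le htβ
  -- Beyond `β'⁻¹` kernels need no comparison: the primed kernel vanishes there, so its moment has
  -- already reached the upper bound `1`.
  · calc _ ≤ 1 := lintegral_Ioo_mul_betaScaledPDF_le_one ha hb hα0 hβ h h1 ht
      _ = ∫⁻ w in Set.Ioo 0 β'⁻¹, ENNReal.ofReal w * betaScaledPDF a' b' α' β' w := by
        rw [lintegral_Ioo_mul_betaScaledPDF ha' hb' hα' hβ'0 h' h1' (inv_pos.2 hβ'0) le_rfl]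
        simp [betaKernel, hβ'0.ne', hb'.ne']
      _ ≤ _ := lintegral_mono_set (Set.Ioo_subset_Ioo_right htβ)

/-! ### Mean, reflection and rescaling of the beta distribution -/

theorem betaPDFReal_nonneg {a b : ℝ} (ha : 0 < a) (hb : 0 < b) (x : ℝ) :
    0 ≤ betaPDFReal a b x := by
  by_cases hx : 0 < x ∧ x < 1
  · exact (betaPDFReal_pos hx.1 hx.2 ha hb).le
  · simp [betaPDFReal, hx]

theorem beta_add_one_left {a b : ℝ} (ha : 0 < a) (hb : 0 < b) :
    beta (a + 1) b = a / (a + b) * beta a b := by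
  have h := (Real.Gamma_pos_of_pos (add_pos ha hb)).ne'
  rw [beta, beta, Real.Gamma_add_one ha.ne', show a + 1 + b = a + b + 1 by ring,
    Real.Gamma_add_one (by positivity)]
  field_simp

theorem integral_id_betaMeasure {a b : ℝ} (ha : 0 < a) (hb : 0 < b) :
    ∫ x, x ∂(betaMeasure a b) = a / (a + b) := by
  have hm : Measurable (betaPDF a b) := (measurable_betaPDFReal a b).ennreal_ofReal
  have h0 := beta_pos ha hb
  have hae : 0 ≤ᵐ[betaMeasure a b] fun x : ℝ => x := by
    rw [betaMeasure]
    refine (ae_withDensity_iff hm).2 (ae_of_all _ fun x hx => ?_)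
    by_contra hx'
    exact hx (betaPDF_eq_zero_of_nonpos (not_le.1 hx').le)
  rw [integral_eq_lintegral_of_nonneg_ae hae (by fun_prop), betaMeasure,
    lintegral_withDensity_eq_lintegral_mul _ hm (by fun_prop)]
  have hmul : ∀ x, (betaPDF a b * fun x => ENNReal.ofReal x) x =
      ENNReal.ofReal (a / (a + b)) * betaPDF (a + 1) b x := by
    intro x
    simp only [Pi.mul_apply, betaPDF]
    rw [← ENNReal.ofReal_mul (betaPDFReal_nonneg ha hb x), ← ENNReal.ofReal_mul (by positivity)]
    congr 1
    by_cases hx : 0 < x ∧ x < 1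
    · simp only [betaPDFReal, hx, and_self, if_true, beta_add_one_left ha hb, add_sub_cancel_right]
      have : x ^ a = x ^ (a - 1) * x := by rw [← Real.rpow_add_one hx.1.ne']; simp
      rw [this]
      field_simp
    · simp [betaPDFReal, hx]
  simp only [hmul]
  have hm' : Measurable (betaPDF (a + 1) b) := (measurable_betaPDFReal _ _).ennreal_ofReal
  rw [lintegral_const_mul _ hm',
    lintegral_betaPDF_eq_one (by positivity) hb, mul_one, ENNReal.toReal_ofReal (by positivity)]

theorem beta_comm (a b : ℝ) : beta a b = beta b a := by
  rw [beta, beta, mul_comm, add_comm]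

theorem betaMeasure_Iio (a b c : ℝ) :
    betaMeasure a b (Set.Iio c) = betaMeasure b a (Set.Ioi (1 - c)) := by
  rw [betaMeasure, betaMeasure, withDensity_apply _ measurableSet_Iio,
    withDensity_apply _ measurableSet_Ioi, ← lintegral_indicator measurableSet_Iio,
    ← lintegral_indicator measurableSet_Ioi, ← lintegral_sub_left_eq_self _ 1]
  refine lintegral_congr fun x => ?_
  have h : 1 - x ∈ Set.Iio c ↔ x ∈ Set.Ioi (1 - c) := by
    simp only [Set.mem_Iio, Set.mem_Ioi]; constructor <;> intro <;> linarith
  by_cases hx : x ∈ Set.Ioi (1 - c)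
  · rw [Set.indicator_of_mem hx, Set.indicator_of_mem (h.2 hx), betaPDF, betaPDF]
    congr 1
    by_cases hx : 0 < x ∧ x < 1
    · rw [betaPDFReal, betaPDFReal, if_pos hx, if_pos ⟨by linarith [hx.2], by linarith [hx.1]⟩,
        beta_comm]
      ring_nf
    · rw [betaPDFReal, betaPDFReal, if_neg hx,
        if_neg fun h => hx ⟨by linarith [h.2], by linarith [h.1]⟩]
  · rw [Set.indicator_of_notMem hx, Set.indicator_of_notMem (fun h' => hx (h.1 h'))]

/-- The mass of a beta distribution above its mean, in the normalized coordinate. The constant is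
symmetric under `(a, α) ↔ (b, β)`. -/
theorem betaMeasure_Ioi_mean {a b α β : ℝ} (ha : 0 < a) (hb : 0 < b) (hα : 0 < α) (hβ : 0 < β)
    (h : a * α = b * β) :
    betaMeasure a b (Set.Ioi (a / (a + b))) =
      ENNReal.ofReal (α * β / (α + β) * ((1 / beta a b) *
        ((a / (a + b)) ^ (a - 1) * (b / (a + b)) ^ (b - 1)))) *
      ∫⁻ w in Set.Ioi (0 : ℝ), betaScaledPDF a b α β w := by
  have h0 := beta_pos ha hb
  set k : ℝ := α * β / (α + β) with hk
  have hk0 : 0 < k := by positivity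
  set m : ℝ := a / (a + b) with hm
  have hm0 : 0 < m := by positivity
  have hkm : k = m * α := by
    rw [hk, hm]; field_simp; linear_combination (-1 : ℝ) * h
  have hkm' : k = b / (a + b) * β := by
    rw [hk]; field_simp; linear_combination h
  have h1m : 1 - m = b / (a + b) := by rw [hm]; field_simp; ring
  have himg : (fun w => m + k * w) '' Set.Ioi 0 = Set.Ioi m := by
    ext x
    simp only [Set.mem_image, Set.mem_Ioi]
    constructor
    · rintro ⟨w, hw, rfl⟩
      have := mul_pos hk0 hw
      linarith
    · intro hx
      refine ⟨(x - m) / k, div_pos (by linarith) hk0, ?_⟩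
      field_simp
      ring
  have hd : ∀ w ∈ Set.Ioi (0 : ℝ), HasDerivWithinAt (fun w => m + k * w) k (Set.Ioi 0) w :=
    fun w _ => by simpa using (((hasDerivAt_id w).const_mul k).const_add m).hasDerivWithinAt
  have hinj : Set.InjOn (fun w => m + k * w) (Set.Ioi 0) := by
    intro x _ y _ hxy
    simpa [hk0.ne'] using hxy
  rw [betaMeasure, withDensity_apply _ measurableSet_Ioi, ← himg,
    lintegral_image_eq_lintegral_abs_deriv_mul measurableSet_Ioi hd hinj,
    ← lintegral_const_mul _ (measurable_betaScaledPDF _ _ _ _)]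
  refine setLIntegral_congr_fun measurableSet_Ioi fun w (hw : 0 < w) => ?_
  have e1 : m + k * w = m * (1 + α * w) := by rw [hkm]; ring
  have e2 : 1 - (m + k * w) = b / (a + b) * (1 - β * w) := by rw [← h1m] at hkm' ⊢; rw [hkm']; ring
  have hx0 : 0 < m + k * w := by positivity
  simp only [betaPDF, betaPDFReal, betaScaledPDF]
  by_cases hw' : w < β⁻¹
  · have hq := one_sub_mul_pos_of_lt_inv hβ hw'
    have hx1 : m + k * w < 1 := by
      have : 0 < b / (a + b) * (1 - β * w) := by positivity
      linarith
    rw [if_pos ⟨hx0, hx1⟩, if_pos hw', abs_of_pos hk0, ← ENNReal.ofReal_mul hk0.le,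
      ← ENNReal.ofReal_mul (by positivity), e2, e1, Real.mul_rpow hm0.le (by positivity),
      Real.mul_rpow (by positivity) hq.le]
    congr 1
    ring
  · have hx1 : ¬ (m + k * w < 1) := by
      intro hx
      have h3 : 0 < b / (a + b) * (1 - β * w) := by linarith
      have h4 : 0 < 1 - β * w := pos_of_mul_pos_right h3 (by positivity)
      exact hw' (by rw [← one_div, lt_div_iff₀ hβ]; linarith)
    rw [if_neg fun h => hx1 h.2, if_neg hw']
    simp

/-- The first equation makes the origin a critical point of the log kernel, and the second sets its
second derivative there to `-1`. Solving them gives these roots. -/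
theorem beta_scale_spec {a b : ℝ} (ha : 0 < a) (hb : 0 < b) :
    0 < √(b / (a * (a + b))) ∧ 0 < √(a / (b * (a + b))) ∧
      a * √(b / (a * (a + b))) = b * √(a / (b * (a + b))) ∧
      a * √(b / (a * (a + b))) * (√(b / (a * (a + b))) + √(a / (b * (a + b)))) = 1 := by
  have p : 0 < √(b / (a * (a + b))) := Real.sqrt_pos.2 (by positivity)
  have q : 0 < √(a / (b * (a + b))) := Real.sqrt_pos.2 (by positivity)
  have hp : √(b / (a * (a + b))) ^ 2 = b / (a * (a + b)) := Real.sq_sqrt (by positivity)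
  have hq : √(a / (b * (a + b))) ^ 2 = a / (b * (a + b)) := Real.sq_sqrt (by positivity)
  have h : a * √(b / (a * (a + b))) = b * √(a / (b * (a + b))) := by
    refine (pow_left_inj₀ (by positivity) (by positivity) two_ne_zero).1 ?_
    rw [mul_pow, mul_pow, hp, hq]
    field_simp
  refine ⟨p, q, h, ?_⟩
  have e : a * √(b / (a * (a + b))) * (√(b / (a * (a + b))) + √(a / (b * (a + b)))) =
      a * √(b / (a * (a + b))) ^ 2 + b * √(a / (b * (a + b))) ^ 2 := by
    linear_combination √(a / (b * (a + b))) * h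
  rw [e, hp, hq]
  field_simp
  ring

/-- What matters is that one `C` serves both sides of the mean, so it drops out of the odds. -/
theorem exists_betaMeasure_real_Ici_mean_eq {a b : ℝ} (ha : 0 < a) (hb : 0 < b) :
    ∃ C : ℝ≥0∞,
      ENNReal.ofReal ((betaMeasure a b).real (Set.Ici (a / (a + b)))) = C *
        ∫⁻ w in Set.Ioi (0 : ℝ), betaScaledPDF a b √(b / (a * (a + b))) √(a / (b * (a + b))) w ∧
      ENNReal.ofReal (1 - (betaMeasure a b).real (Set.Ici (a / (a + b)))) = C *
        ∫⁻ w in Set.Ioi (0 : ℝ),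
          betaScaledPDF b a √(a / (b * (a + b))) √(b / (a * (a + b))) w := by
  have := isProbabilityMeasureBeta ha hb
  have := isProbabilityMeasureBeta hb ha
  obtain ⟨hα, hβ, h, -⟩ := beta_scale_spec ha hb
  refine ⟨ENNReal.ofReal (√(b / (a * (a + b))) * √(a / (b * (a + b))) /
    (√(b / (a * (a + b))) + √(a / (b * (a + b)))) * ((1 / beta a b) *
      ((a / (a + b)) ^ (a - 1) * (b / (a + b)) ^ (b - 1)))), ?_, ?_⟩
  · rw [ofReal_measureReal, ← betaMeasure_Ioi_mean ha hb hα hβ h]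
    have : NullSingletonClass (betaMeasure a b) := by rw [betaMeasure]; infer_instance
    exact (measure_congr Ioi_ae_eq_Ici).symm
  · rw [← probReal_compl_eq_one_sub measurableSet_Ici, Set.compl_Ici, ofReal_measureReal,
      betaMeasure_Iio, show 1 - a / (a + b) = b / (b + a) by field_simp; ring,
      betaMeasure_Ioi_mean hb ha hβ hα h.symm, beta_comm b a]
    congr 2
    ring_nf

/-! ### Comparison of the odds and conclusion -/

theorem betaMeasure_real_Ici_mean_mono {a b a' b' : ℝ} (ha : 0 < a) (hb' : 0 < b')
    (haa : a ≤ a') (hbb : b' ≤ b) :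
    (betaMeasure a b).real (Set.Ici (a / (a + b))) ≤
      (betaMeasure a' b').real (Set.Ici (a' / (a' + b'))) := by
  have ha' := ha.trans_le haa
  have hb := hb'.trans_le hbb
  have := isProbabilityMeasureBeta ha hb
  have := isProbabilityMeasureBeta ha' hb'
  obtain ⟨C, hC, hC1⟩ := exists_betaMeasure_real_Ici_mean_eq ha hb
  obtain ⟨C', hC', hC1'⟩ := exists_betaMeasure_real_Ici_mean_eq ha' hb'
  obtain ⟨hα, hβ, h, h1⟩ := beta_scale_spec ha hb
  obtain ⟨hα', hβ', h', h1'⟩ := beta_scale_spec ha' hb'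
  have hαα : √(b' / (a' * (a' + b'))) ≤ √(b / (a * (a + b))) := by
    refine Real.sqrt_le_sqrt ?_
    rw [div_le_div_iff₀ (by positivity) (by positivity)]
    have e1 : b' * a ^ 2 ≤ b * a' ^ 2 := by gcongr
    have e2 : a * (b * b') ≤ a' * (b * b') := by gcongr
    linarith
  have hββ : √(a / (b * (a + b))) ≤ √(a' / (b' * (a' + b'))) := by
    refine Real.sqrt_le_sqrt ?_
    rw [div_le_div_iff₀ (by positivity) (by positivity)]
    have e1 : a * b' ^ 2 ≤ a' * b ^ 2 := by gcongr
    have e2 : b' * (a * a') ≤ b * (a * a') := by gcongr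
    linarith
  -- `hG` compares the masses above the mean; `hS` compares those below it, reflected, with the two
  -- parameter pairs in the opposite order.
  have hG := lintegral_betaScaledPDF_mono ha hb ha' hb' hα' hβ hαα hββ h h1 h' h1'
  have hS := lintegral_betaScaledPDF_mono hb' ha' hb ha hβ hα' hββ hαα h'.symm
    (by rw [← h', add_comm √_]; exact h1') h.symm (by rw [← h, add_comm √_]; exact h1)
  generalize hp : (betaMeasure a b).real (Set.Ici (a / (a + b))) = p at *
  generalize hp' : (betaMeasure a' b').real (Set.Ici (a' / (a' + b'))) = p' at *
  have p0 : 0 ≤ p := hp ▸ measureReal_nonneg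
  have p0' : 0 ≤ p' := hp' ▸ measureReal_nonneg
  have p1 : p ≤ 1 := hp ▸ measureReal_le_one
  have p1' : p' ≤ 1 := hp' ▸ measureReal_le_one
  -- The odds inequality, cross-multiplied: both sides carry the factor `C * C'`, so neither
  -- constant has to be compared or divided out.
  have key : ENNReal.ofReal (p * (1 - p')) ≤ ENNReal.ofReal (p' * (1 - p)) := by
    rw [ENNReal.ofReal_mul p0, ENNReal.ofReal_mul p0', hC, hC', hC1, hC1', mul_mul_mul_comm,
      mul_mul_mul_comm C', mul_comm C']
    gcongr
  have := (ENNReal.ofReal_le_ofReal_iff (mul_nonneg p0' (by linarith))).1 key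
  linarith

theorem measureReal_mean_le_of_hasLaw_beta {Ω : Type*} [MeasurableSpace Ω] {P : Measure Ω}
    {X : Ω → ℝ} {a b : ℝ} (ha : 0 < a) (hb : 0 < b) (hX : HasLaw X (betaMeasure a b) P) :
    P.real {ω | ∫ ω', X ω' ∂P ≤ X ω} = (betaMeasure a b).real (Set.Ici (a / (a + b))) := by
  rw [hX.integral_eq, integral_id_betaMeasure ha hb]
  exact hX.measureReal_eq (p := fun x => a / (a + b) ≤ x) measurableSet_Ici

theorem corollary8 {Ω : ℝ → ℝ → Type*} [∀ a b, MeasurableSpace (Ω a b)]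
    (P : ∀ a b, Measure (Ω a b)) (X : ∀ a b, Ω a b → ℝ)
    (hX : ∀ a b, 0 < a → 0 < b → HasLaw (X a b) (betaMeasure a b) (P a b)) :
    (∀ b, 0 < b →
      MonotoneOn (fun a => (P a b).real {ω | ∫ ω', X a b ω' ∂(P a b) ≤ X a b ω})
        (Set.Ioi 0)) ∧
    (∀ a, 0 < a →
      AntitoneOn (fun b => (P a b).real {ω | ∫ ω', X a b ω' ∂(P a b) ≤ X a b ω})
        (Set.Ioi 0)) := by
  refine ⟨fun b hb a ha a' ha' h => ?_, fun a ha b hb b' hb' h => ?_⟩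
  · simp only [measureReal_mean_le_of_hasLaw_beta ha hb (hX a b ha hb),
      measureReal_mean_le_of_hasLaw_beta ha' hb (hX a' b ha' hb)]
    exact betaMeasure_real_Ici_mean_mono ha hb h le_rfl
  · simp only [measureReal_mean_le_of_hasLaw_beta ha hb (hX a b ha hb),
      measureReal_mean_le_of_hasLaw_beta ha hb' (hX a b' ha hb')]
    exact betaMeasure_real_Ici_mean_mono ha hb le_rfl h
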